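/- Let $k$ be a field with algebraic closure $\bar k$, let $B$ be an associative unital (not necessarily commutative) $k$-algebra, and let $A \subseteq B$ be a $k$-subalgebra. Suppose $B$ has a finite-dimensional filtration $V = \{V_n\}_{n \in \mathbb{N}}$, that is, finite-dimensional $k$-subspaces $V_n \subseteq B$ with $V_n \subseteq V_m$ for $n \le m$, $V_n V_m \subseteq V_{n+m}$ for all $n, m \ge 0$, and $\bigcup_n V_n = B$. Let $\mathrm{gr}_V(B) = \bigoplus_{n \ge 0} V_n / V_{n-1}$ (with $V_{-1} = 0$) be the associated graded algebra, and suppose that $\mathrm{gr}_V(B) \otimes_k \bar k$ is a (not necessarily commutative) domain. Then $A$ is a finite factorization domain: $A$ is a (not necessarily commutative) domain, every nonzero non-unit of $A$ is a product of finitely many irreducible elements of $A$, and every nonzero non-unit of $A$ has only finitely many factorizations $a = p_1 \cdots p_r$ into irreducible elements, where $p_1 \cdots p_r$ and $q_1 \cdots q_s$ are identified if $r = s$ and, for each $i$, $q_i = u_i p_i$ for some unit $u_i$ of $A$ lying in the center of $A$. -/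

import Mathlib

open scoped TensorProduct DirectSum

/-- An `ℕ`-filtration of a `k`-algebra `B`: an increasing sequence of `k`-subspaces whose union
is `B` and which satisfies `V m * V n ⊆ V (m + n)`. -/
structure AlgFiltration (k B : Type*) [Field k] [Ring B] [Algebra k B] where
  /-- The subspaces forming the filtration. -/
  space : ℕ → Submodule k B
  mono : Monotone space
  exhaustive : ∀ b : B, ∃ n, b ∈ space n
  mul_mem : ∀ {m n : ℕ} {x y : B}, x ∈ space m → y ∈ space n → x * y ∈ space (m + n)

namespace AlgFiltration

variable {k B : Type*} [Field k] [Ring B] [Algebra k B] (V : AlgFiltration k B)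

/-- The filtration is finite-dimensional if each of its subspaces is. -/
def IsFiniteDimensional : Prop :=
  ∀ n, FiniteDimensional k (V.space n)

/-- The space `V (n - 1)`, with `V (-1) = 0`. -/
def pred : ℕ → Submodule k B
  | 0 => ⊥
  | n + 1 => V.space n

theorem mul_mem_pred_left {m n : ℕ} {x y : B} (hx : x ∈ V.pred m) (hy : y ∈ V.space n) :
    x * y ∈ V.pred (m + n) := by
  cases m with
  | zero =>
    obtain rfl : x = 0 := hx
    rw [zero_mul]
    exact Submodule.zero_mem _
  | succ m =>
    rw [Nat.succ_add]
    exact V.mul_mem (m := m) hx hy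

theorem mul_mem_pred_right {m n : ℕ} {x y : B} (hx : x ∈ V.space m) (hy : y ∈ V.pred n) :
    x * y ∈ V.pred (m + n) := by
  cases n with
  | zero =>
    obtain rfl : y = 0 := hy
    rw [mul_zero]
    exact Submodule.zero_mem _
  | succ n => exact V.mul_mem (n := n) hx hy

/-- `V (n - 1)` as a subspace of `V n`. -/
def predIn (n : ℕ) : Submodule k (V.space n) :=
  (V.pred n).comap (V.space n).subtype

/-- The `n`-th homogeneous component `V n / V (n - 1)` of the associated graded algebra. -/
def Piece (n : ℕ) : Type _ :=
  V.space n ⧸ V.predIn n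

instance instAddCommGroupPiece (n : ℕ) : AddCommGroup (V.Piece n) :=
  inferInstanceAs (AddCommGroup (V.space n ⧸ V.predIn n))

instance instModulePiece (n : ℕ) : Module k (V.Piece n) :=
  inferInstanceAs (Module k (V.space n ⧸ V.predIn n))

/-- The projection `V n → V n / V (n - 1)`. -/
def proj (n : ℕ) : V.space n →ₗ[k] V.Piece n :=
  (V.predIn n).mkQ

theorem proj_eq_zero_iff {n : ℕ} (x : V.space n) : V.proj n x = 0 ↔ (x : B) ∈ V.pred n :=
  Submodule.Quotient.mk_eq_zero _

theorem proj_surjective (n : ℕ) : Function.Surjective (V.proj n) :=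
  Submodule.mkQ_surjective _

/-- The class in `V n / V (n - 1)` of an element of `V n`. -/
def cls (n : ℕ) (x : B) (hx : x ∈ V.space n) : V.Piece n :=
  V.proj n ⟨x, hx⟩

/-- The multiplication of `B`, as a bilinear map from `V m × V n` to `V (m + n) / V (m + n - 1)`. -/
def mulToPiece (m n : ℕ) : V.space m →ₗ[k] V.space n →ₗ[k] V.Piece (m + n) :=
  LinearMap.mk₂ k (fun x y => V.cls (m + n) (x.1 * y.1) (V.mul_mem x.2 y.2))
    (fun x x' y => by
      simp only [cls, ← map_add]; congr 1; ext; simp [add_mul])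
    (fun c x y => by
      simp only [cls, ← map_smul]; congr 1; ext; simp)
    (fun x y y' => by
      simp only [cls, ← map_add]; congr 1; ext; simp [mul_add])
    (fun c x y => by
      simp only [cls, ← map_smul]; congr 1; ext; simp)

/-- The multiplication `V m / V (m - 1) × V n / V (n - 1) → V (m + n) / V (m + n - 1)` induced by
the multiplication of `B`. -/
def pieceMul (m n : ℕ) : V.Piece m →ₗ[k] V.Piece n →ₗ[k] V.Piece (m + n) :=
  LinearMap.liftQ₂ (V.predIn m) (V.predIn n) (V.mulToPiece m n)
    (fun x hx => by
      rw [LinearMap.mem_ker]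
      ext y
      exact (V.proj_eq_zero_iff _).2 (V.mul_mem_pred_left hx y.2))
    (fun y hy => by
      rw [LinearMap.mem_ker]
      ext x
      exact (V.proj_eq_zero_iff _).2 (V.mul_mem_pred_right x.2 hy))

theorem pieceMul_cls {m n : ℕ} {x y : B} (hx : x ∈ V.space m) (hy : y ∈ V.space n) :
    V.pieceMul m n (V.cls m x hx) (V.cls n y hy) = V.cls (m + n) (x * y) (V.mul_mem hx hy) :=
  rfl

theorem exists_cls {n : ℕ} (p : V.Piece n) : ∃ x hx, p = V.cls n x hx := by
  obtain ⟨x, rfl⟩ := V.proj_surjective n p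
  exact ⟨x.1, x.2, rfl⟩

instance instGMul : DirectSum.GNonUnitalNonAssocSemiring V.Piece where
  mul {m n} x y := V.pieceMul m n x y
  mul_zero _ := map_zero _
  zero_mul _ := by simp
  mul_add _ _ _ := map_add _ _ _
  add_mul _ _ _ := by simp

/-- The associated graded algebra `⨁ n, V n / V (n - 1)`.  It is constructed for every filtration;
since `1 ∈ V 0` is not demanded, it is a priori an algebra without unit. -/
abbrev Gr : Type _ :=
  ⨁ n, V.Piece n

theorem of_cls_congr {m n : ℕ} {x y : B} (hx : x ∈ V.space m) (hy : y ∈ V.space n)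
    (hmn : m = n) (hxy : x = y) :
    DirectSum.of V.Piece m (V.cls m x hx) = DirectSum.of V.Piece n (V.cls n y hy) := by
  subst hmn hxy
  rfl

theorem of_mul_of_cls {m n : ℕ} {x y : B} (hx : x ∈ V.space m) (hy : y ∈ V.space n) :
    (DirectSum.of V.Piece m (V.cls m x hx) * DirectSum.of V.Piece n (V.cls n y hy) : V.Gr) =
      DirectSum.of V.Piece (m + n) (V.cls (m + n) (x * y) (V.mul_mem hx hy)) :=
  DirectSum.of_mul_of _ _

theorem gr_mul_assoc (a b c : V.Gr) : a * b * c = a * (b * c) := by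
  induction a using DirectSum.induction_on with
  | zero => simp only [zero_mul]
  | add a a' ha ha' => simp only [add_mul, ha, ha']
  | of l x =>
    induction b using DirectSum.induction_on with
    | zero => simp only [zero_mul, mul_zero]
    | add b b' hb hb' => simp only [add_mul, mul_add, hb, hb']
    | of m y =>
      induction c using DirectSum.induction_on with
      | zero => simp only [mul_zero]
      | add c c' hc hc' => simp only [mul_add, hc, hc']
      | of n z =>
        obtain ⟨x, hx, rfl⟩ := V.exists_cls x
        obtain ⟨y, hy, rfl⟩ := V.exists_cls y
        obtain ⟨z, hz, rfl⟩ := V.exists_cls z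
        simp only [of_mul_of_cls]
        exact V.of_cls_congr _ _ (add_assoc _ _ _) (mul_assoc _ _ _)

instance instNonUnitalRingGr : NonUnitalRing V.Gr where
  toAddCommGroup := inferInstance
  __ := (inferInstance : NonUnitalNonAssocSemiring V.Gr)
  mul_assoc := V.gr_mul_assoc

instance instIsScalarTowerGr : IsScalarTower k V.Gr V.Gr where
  smul_assoc r a b := by
    simp only [smul_eq_mul]
    induction a using DirectSum.induction_on with
    | zero => simp only [zero_mul, smul_zero]
    | add a a' ha ha' => simp only [smul_add, add_mul, ha, ha']
    | of m x =>
      induction b using DirectSum.induction_on with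
      | zero => simp only [mul_zero, smul_zero]
      | add b b' hb hb' => simp only [smul_add, mul_add, hb, hb']
      | of n y =>
        rw [← DirectSum.of_smul, DirectSum.of_mul_of, DirectSum.of_mul_of, ← DirectSum.of_smul]
        exact congrArg _ (LinearMap.map_smul₂ (V.pieceMul m n) r x y)

instance instSMulCommClassGr : SMulCommClass k V.Gr V.Gr where
  smul_comm r a b := by
    simp only [smul_eq_mul]
    induction a using DirectSum.induction_on with
    | zero => simp only [zero_mul, smul_zero]
    | add a a' ha ha' => simp only [smul_add, add_mul, ha, ha']
    | of m x =>
      induction b using DirectSum.induction_on with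
      | zero => simp only [mul_zero, smul_zero]
      | add b b' hb hb' => simp only [smul_add, mul_add, hb, hb']
      | of n y =>
        rw [← DirectSum.of_smul, DirectSum.of_mul_of, DirectSum.of_mul_of, ← DirectSum.of_smul]
        exact congrArg _ (LinearMap.map_smul (V.pieceMul m n x) r y).symm

end AlgFiltration

/-- A ring, not presupposed to have an identity, is a (not necessarily commutative) domain:
it has an identity, it is nonzero, and it has no zero divisors. -/
structure IsNoncommDomain (R : Type*) [NonUnitalRing R] : Prop where
  exists_one : ∃ e : R, ∀ x : R, e * x = x ∧ x * e = x
  exists_ne_zero : ∃ x : R, x ≠ 0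
  eq_zero_or_eq_zero : ∀ x y : R, x * y = 0 → x = 0 ∨ y = 0

section Factorization

variable {A : Type*} [Ring A]

/-- Two elements are equal up to multiplication by a central unit of `A`. -/
def CentralAssoc (x y : A) : Prop :=
  ∃ u : Aˣ, (u : A) ∈ Subring.center A ∧ y = u * x

theorem CentralAssoc.refl (x : A) : CentralAssoc x x :=
  ⟨1, by simp, by simp⟩

theorem CentralAssoc.symm {x y : A} (h : CentralAssoc x y) : CentralAssoc y x := by
  obtain ⟨u, hu, rfl⟩ := h
  refine ⟨u⁻¹, ?_, by simp⟩
  rw [Subring.mem_center_iff] at hu ⊢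
  intro g
  have h : Commute g (u : A) := hu g
  exact h.units_inv_right

theorem CentralAssoc.trans {x y z : A} (h : CentralAssoc x y) (h' : CentralAssoc y z) :
    CentralAssoc x z := by
  obtain ⟨u, hu, rfl⟩ := h
  obtain ⟨v, hv, rfl⟩ := h'
  exact ⟨v * u, by simpa using Subring.mul_mem _ hv hu, by simp [mul_assoc]⟩

/-- The factorizations `a = p₁ ⋯ pᵣ` of `a` into irreducible elements, as ordered lists. -/
def IrredFactorization (a : A) : Type _ :=
  {l : List A // (∀ p ∈ l, Irreducible p) ∧ l.prod = a}

/-- Two factorizations are identified if they have the same length and corresponding factors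
agree up to multiplication by central units. -/
def irredFactorizationSetoid (a : A) : Setoid (IrredFactorization a) where
  r f g := List.Forall₂ CentralAssoc f.1 g.1
  iseqv :=
    { refl := fun f => List.forall₂_same.2 fun x _ => CentralAssoc.refl x
      symm := fun h => (h.imp fun _ _ hxy => hxy.symm).flip
      trans := fun {f g h} hfg hgh => by
        obtain ⟨f, _⟩ := f
        obtain ⟨g, _⟩ := g
        obtain ⟨h, _⟩ := h
        dsimp only at hfg hgh ⊢
        clear * - hfg hgh
        induction hfg generalizing h with
        | nil => exact hgh
        | cons hxy _ ih =>
          cases hgh with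
          | cons hyz hl => exact .cons (hxy.trans hyz) (ih _ hl) }

end Factorization

/-- A finite factorization domain: a (not necessarily commutative) domain in which every nonzero
non-unit has at least one factorization into irreducible elements, and only finitely many up to
multiplication of the irreducible factors by central units. -/
structure IsFFD (A : Type*) [Ring A] : Prop where
  isDomain : IsDomain A
  nonempty : ∀ a : A, a ≠ 0 → ¬ IsUnit a → Nonempty (IrredFactorization a)
  finite : ∀ a : A, a ≠ 0 → ¬ IsUnit a → Finite (Quotient (irredFactorizationSetoid a))

/-! ### Finiteness of rank-one tensors in a fibre of a bilinear map. -/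

section FiniteFibres

open MvPolynomial

/-! Write `K` for the algebraic closure. Leading symbols carry the absence of zero divisors from `gr
B ⊗ K` to `B ⊗ K` (`baseChange_mul_ne_zero`) and make the degree additive (`degree_mul`). Elements
of degree zero in `A` are units, so splitting into non-units lowers the degree and factorizations
exist.

For finiteness, both factors of `a = p * c` lie in the finite-dimensional space `E = V (deg a)`, and
`p ⊗ c` is a rank-one tensor sent to `a` by multiplication. Over `K`, such tensors form an affine
variety. A point at infinity would be a nonzero rank-one tensor killed by multiplication, that is, a
pair of zero divisors in `B ⊗ K`. The variety thus has no point at infinity and is finite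
(`finite_rankOne_of_bilinear`). The tensor determines `p` up to a scalar of `k`, which is a central
unit; so `a` has finitely many left factors up to scalars, and induction on the degree of the
cofactor finishes (`exists_finite_factorizations`). -/

theorem Finsupp.prod_pow_mem_pow_degree {σ K R : Type*} [CommSemiring K] [CommSemiring R]
    [Algebra K R] (s : σ →₀ ℕ) {z : σ → R} {W : Submodule K R} (hW : ∀ j, z j ∈ W) :
    (s.prod fun j e => z j ^ e) ∈ W ^ s.degree := by
  classical
  induction s using Finsupp.induction with
  | zero => simp [Submodule.one_le.1 le_rfl]
  | single_add j n s hj hn ih =>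
    rw [Finsupp.prod_add_index' (by simp) (by intros; rw [pow_add]), map_add, pow_add,
      Finsupp.prod_single_index (by simp), Finsupp.degree_single]
    exact Submodule.mul_mem_mul (Submodule.pow_mem_pow _ (hW j) _) ih

theorem MvPolynomial.IsHomogeneous.aeval_mem_pow {σ K R : Type*} [CommSemiring K] [CommSemiring R]
    [Algebra K R] {p : MvPolynomial σ K} {d : ℕ} (hp : p.IsHomogeneous d) {z : σ → R}
    {W : Submodule K R} (hW : ∀ j, z j ∈ W) : MvPolynomial.aeval z p ∈ W ^ d := by
  rw [p.as_sum, map_sum]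
  refine Submodule.sum_mem _ fun s hs => ?_
  rw [aeval_monomial, ← Algebra.smul_def]
  refine Submodule.smul_mem _ _ ?_
  obtain rfl : s.degree = d := (hp.degree_eq_sum_deg_support hs).symm
  exact s.prod_pow_mem_pow_degree hW

/-- If homogeneous polynomials have no common zero except the origin, then any tuple at which they
take values of lower degree consists of integral elements. -/
theorem MvPolynomial.isIntegral_of_aeval_mem_pow {σ ι K R : Type*} [Finite σ] [Field K]
    [IsAlgClosed K] [CommRing R] [Algebra K R] (f : ι → MvPolynomial σ K) (d : ι → ℕ)
    (hf : ∀ i, (f i).IsHomogeneous (d i + 1))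
    (hzero : ∀ x : σ → K, (∀ i, aeval x (f i) = 0) → x = 0) (z : σ → R)
    (hz : ∀ i, aeval z (f i) ∈ Submodule.span K (insert 1 (Set.range z)) ^ d i) (j : σ) :
    IsIntegral K (z j) := by
  classical
  set W : Submodule K R := Submodule.span K (insert 1 (Set.range z)) with hWdef
  have hone : (1 : R) ∈ W := Submodule.subset_span (Set.mem_insert _ _)
  have hW : ∀ j, z j ∈ W := fun j => Submodule.subset_span (Set.mem_insert_of_mem _ ⟨j, rfl⟩)
  have hfg : W.FG := Submodule.fg_span ((Set.finite_range z).insert 1)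
  set I : Ideal (MvPolynomial σ K) := Ideal.span (Set.range f)
  set J : Ideal (MvPolynomial σ K) := Ideal.span (Set.range X)
  -- Nullstellensatz: the variables vanish at every common zero of the `f i`, so a power of `J` lies
  -- in `I`.
  have hJI : J ≤ I.radical := by
    rw [← vanishingIdeal_zeroLocus_eq_radical (K := K), Ideal.span_le]
    rintro _ ⟨i, rfl⟩ x hx
    have : x = 0 := hzero x fun l => hx _ (Ideal.subset_span ⟨l, rfl⟩)
    simp [this]
  obtain ⟨m, hm⟩ := Ideal.exists_pow_le_of_le_radical_of_fg hJI (IsNoetherian.noetherian J)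
  have h1 : (1 : Submodule K R) ≤ W := Submodule.one_le.2 hone
  -- Each generator loses one degree on evaluation at `z`, hence so does every homogeneous element
  -- of `I` of positive degree.
  have key : ∀ p ∈ I, ∀ m, aeval z (homogeneousComponent (m + 1) p) ∈ W ^ m := by
    intro p hp m
    obtain ⟨c, rfl⟩ := Finsupp.mem_ideal_span_range_iff_exists_finsupp.1 hp
    rw [Finsupp.sum, map_sum, map_sum]
    refine Submodule.sum_mem _ fun i _ => ?_
    rw [← sum_homogeneousComponent (c i), Finset.sum_mul, map_sum, map_sum]
    refine Submodule.sum_mem _ fun e _ => ?_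
    have hc : (homogeneousComponent e (c i)).IsHomogeneous e :=
      homogeneousComponent_isHomogeneous e (c i)
    rw [homogeneousComponent_of_mem (hc.mul (hf i))]
    split_ifs with h
    · obtain rfl : m = e + d i := by omega
      rw [map_mul, pow_add]
      exact Submodule.mul_mem_mul (hc.aeval_mem_pow hW) (hz i)
    · simp
  have hhom : ∀ p : MvPolynomial σ K, p.IsHomogeneous (m + 1) → aeval z p ∈ W ^ m := by
    intro p hp
    have hpI : p ∈ I := by
      refine hm (Ideal.pow_le_pow_right (Nat.le_succ m) ?_)
      rw [p.as_sum]
      refine Ideal.sum_mem _ fun s hs => ?_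
      rw [monomial_eq]
      refine Ideal.mul_mem_left _ _ ?_
      have hs : s.degree = m + 1 := (hp.degree_eq_sum_deg_support hs).symm
      rw [Nat.succ_eq_add_one, ← hs]
      exact s.prod_pow_mem_pow_degree fun j => Ideal.subset_span ⟨j, rfl⟩
    simpa [homogeneousComponent_of_mem hp] using key p hpI m
  have hpoly : ∀ n, ∀ x ∈ W ^ n, ∃ p : MvPolynomial σ K, p.totalDegree ≤ n ∧ aeval z p = x := by
    intro n
    have hW' : W ≤ (restrictTotalDegree σ K 1).map (aeval z).toLinearMap := by
      rw [hWdef, Submodule.span_le]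
      rintro _ (rfl | ⟨i, rfl⟩)
      · exact ⟨1, (mem_restrictTotalDegree _ _ _).2 (by simp), map_one (aeval z)⟩
      · exact ⟨X i, (mem_restrictTotalDegree _ _ _).2 (by simp), by simp⟩
    intro x hx
    induction hx using Submodule.pow_induction_on_left' with
    | algebraMap r => exact ⟨C r, by simp, by simp⟩
    | add x y i _ _ hx hy =>
      obtain ⟨p, hp, rfl⟩ := hx
      obtain ⟨q, hq, rfl⟩ := hy
      exact ⟨p + q, (totalDegree_add _ _).trans (max_le hp hq), map_add _ _ _⟩
    | mem_mul y hy i x _ hx =>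
      obtain ⟨p, hp, rfl⟩ := hx
      obtain ⟨q, hq, rfl⟩ := hW' hy
      have := (mem_restrictTotalDegree _ _ _).1 hq
      exact ⟨q * p, (totalDegree_mul _ _).trans (by omega), by simp⟩
  -- The powers of `W` stabilize at `m`, so `W ^ m` is a subalgebra of finite dimension and its
  -- elements are integral.
  have hsucc : W ^ (m + 1) ≤ W ^ m := by
    intro x hx
    obtain ⟨p, hp, rfl⟩ := hpoly _ x hx
    rw [← sum_homogeneousComponent p, map_sum]
    refine Submodule.sum_mem _ fun i hi => ?_
    have hi' : i ≤ m + 1 := by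
      have := Finset.mem_range.1 hi
      omega
    have hc : (homogeneousComponent i p).IsHomogeneous i := homogeneousComponent_isHomogeneous i p
    rcases hi'.eq_or_lt with rfl | hlt
    · exact hhom _ hc
    · exact pow_le_pow_right' h1 (Nat.lt_succ_iff.1 hlt) (hc.aeval_mem_pow hW)
  have hle : ∀ n, W ^ n ≤ W ^ m := by
    intro n
    induction n with
    | zero => exact pow_le_pow_right' h1 (Nat.zero_le m)
    | succ n ih =>
      rw [pow_succ]
      exact (mul_le_mul_left ih W).trans ((pow_succ W m).symm.le.trans hsucc)
  refine IsIntegral.of_mem_of_fg ((W ^ m).toSubalgebra (hle 0 (by simp [Submodule.one_le.1 le_rfl]))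
    fun x y hx hy => hle (m + m) (pow_add W m m ▸ Submodule.mul_mem_mul hx hy)) (hfg.pow m) _ ?_
  exact hle 1 (by simpa using hW j)

/-- A bilinear map without zero divisors over an algebraically closed field represents a given
vector by only finitely many rank one tensors. -/
theorem finite_rankOne_of_bilinear {ι₁ ι₂ ι K : Type*} [Fintype ι₁] [Fintype ι₂] [Field K]
    [IsAlgClosed K] (c : ι → ι₁ → ι₂ → K)
    (hc : ∀ (v : ι₁ → K) (w : ι₂ → K), (∀ l, ∑ i, ∑ j, c l i j * (v i * w j) = 0) →
      v = 0 ∨ w = 0) (u : ι → K) :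
    {t : ι₁ × ι₂ → K | ∃ (v : ι₁ → K) (w : ι₂ → K), (∀ i j, t (i, j) = v i * w j) ∧
      ∀ l, ∑ i, ∑ j, c l i j * (v i * w j) = u l}.Finite := by
  classical
  set S := {t : ι₁ × ι₂ → K | ∃ (v : ι₁ → K) (w : ι₂ → K), (∀ i j, t (i, j) = v i * w j) ∧
      ∀ l, ∑ i, ∑ j, c l i j * (v i * w j) = u l}
  -- The coordinates are viewed as functions on `S`. The equations used are the 2 × 2 minors, which
  -- vanish on `S`, and the linear forms of the bilinear map, which are constant on `S`; `d` is one
  -- less than their degrees.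
  let z : ι₁ × ι₂ → S → K := fun p t => t.1 p
  let f : (ι₁ × ι₂ × ι₁ × ι₂) ⊕ ι → MvPolynomial (ι₁ × ι₂) K :=
    Sum.elim (fun q => X (q.1, q.2.1) * X (q.2.2.1, q.2.2.2) - X (q.1, q.2.2.2) * X (q.2.2.1, q.2.1))
      (fun l => ∑ i, ∑ j, C (c l i j) * X (i, j))
  let d : (ι₁ × ι₂ × ι₁ × ι₂) ⊕ ι → ℕ := Sum.elim (fun _ => 1) (fun _ => 0)
  have hint : ∀ p, IsIntegral K (z p) := by
    refine isIntegral_of_aeval_mem_pow f d ?_ ?_ z ?_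
    · rintro (q | l)
      · exact ((isHomogeneous_X _ _).mul (isHomogeneous_X _ _)).sub
          ((isHomogeneous_X _ _).mul (isHomogeneous_X _ _))
      · exact IsHomogeneous.sum _ _ _ fun i _ => IsHomogeneous.sum _ _ _ fun j _ =>
          isHomogeneous_C_mul_X _ _
    · intro x hx
      by_contra hne
      obtain ⟨⟨a, b⟩, hab⟩ := Function.ne_iff.1 hne
      rw [Pi.zero_apply] at hab
      -- Vanishing minors factor `x` through its column and row at a nonzero entry.
      have hx1 : ∀ i j, x (i, j) = x (i, b) * (x (a, j) / x (a, b)) := fun i j => by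
        have := hx (.inl (i, j, a, b))
        simp only [f, Sum.elim_inl, map_sub, map_mul, aeval_X] at this
        rw [mul_div_assoc', eq_div_iff hab]
        linear_combination this
      have h := hc (fun i => x (i, b)) (fun j => x (a, j) / x (a, b)) fun l => by
        have := hx (.inr l)
        simp only [f, Sum.elim_inr, map_sum, map_mul, aeval_X, aeval_C,
          Algebra.algebraMap_self_apply] at this
        rw [← this]
        exact Finset.sum_congr rfl fun i _ => Finset.sum_congr rfl fun j _ => by rw [hx1 i j]
      rcases h with h | h
      · exact hab (congrFun h a)
      · exact div_ne_zero hab hab (congrFun h b)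
    · rintro (q | l)
      · convert! Submodule.zero_mem _
        ext ⟨t, v, w, ht, -⟩
        simp only [f, z, Sum.elim_inl, map_sub, map_mul, aeval_X, Pi.sub_apply, Pi.mul_apply, ht,
          Pi.zero_apply]
        ring
      · have : aeval z (f (.inr l)) = algebraMap K (S → K) (u l) := by
          ext ⟨t, v, w, ht, hu⟩
          simp [f, z, ht, ← hu]
        rw [this]
        simp [d]
  choose p hp hp0 using hint
  -- An integral function on `S` takes its values among the roots of a single polynomial.
  refine (Set.Finite.pi' fun q => (p q).rootSet_finite K).subset fun t ht q => ?_
  rw [Polynomial.mem_rootSet]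
  refine ⟨(hp q).ne_zero, ?_⟩
  have h := congrFun (hp0 q) ⟨t, ht⟩
  rw [← Polynomial.aeval_def] at h
  have h2 := Polynomial.aeval_algHom_apply (Pi.evalAlgHom K (fun _ : S => K) ⟨t, ht⟩) (z q) (p q)
  simpa [z] using h2.trans h

end FiniteFibres

/-! ### Leading symbols and additivity of the degree. -/

namespace AlgFiltration

section Domain

variable {k B : Type*} [Field k] [Ring B] [Algebra k B] (V : AlgFiltration k B)

/-- The map `V n → gr B` onto the `n`-th homogeneous component. -/
noncomputable def toGr (n : ℕ) : V.space n →ₗ[k] V.Gr :=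
  DirectSum.lof k ℕ V.Piece n ∘ₗ V.proj n

variable (K : Type*) [Field K] [Algebra k K]

/-- A single lift `t` computes the product in `B ⊗ K` and the product of the symbols in `gr B ⊗ K`,
which allows the two to be compared. -/
theorem exists_mul_lift {m n : ℕ} (x : V.space m ⊗[k] K) (y : V.space n ⊗[k] K) :
    ∃ t : V.space (m + n) ⊗[k] K,
      (V.space (m + n)).subtype.rTensor K t =
        (V.space m).subtype.rTensor K x * (V.space n).subtype.rTensor K y ∧
      (V.toGr (m + n)).rTensor K t = (V.toGr m).rTensor K x * (V.toGr n).rTensor K y := by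
  induction x using TensorProduct.induction_on with
  | zero => exact ⟨0, by simp, by simp⟩
  | add x x' hx hx' =>
    obtain ⟨t, h1, h2⟩ := hx
    obtain ⟨t', h1', h2'⟩ := hx'
    exact ⟨t + t', by simp [h1, h1', add_mul], by simp [h2, h2', add_mul]⟩
  | tmul b c =>
    induction y using TensorProduct.induction_on with
    | zero => exact ⟨0, by simp, by simp⟩
    | add x x' hx hx' =>
      obtain ⟨t, h1, h2⟩ := hx
      obtain ⟨t', h1', h2'⟩ := hx'
      exact ⟨t + t', by simp [h1, h1', mul_add], by simp [h2, h2', mul_add]⟩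
    | tmul b' c' =>
      refine ⟨⟨b.1 * b'.1, V.mul_mem b.2 b'.2⟩ ⊗ₜ (c * c'), by simp, ?_⟩
      simp only [LinearMap.rTensor_tmul, Algebra.TensorProduct.tmul_mul_tmul]
      congr 1
      exact (V.of_mul_of_cls b.2 b'.2).symm

/-- Take `n` minimal. If the symbol vanished, right exactness of the tensor product would make `x`
come from `V (n - 1) ⊗ K`. -/
theorem exists_toGr_ne_zero {x : B ⊗[k] K} (hx : x ≠ 0) :
    ∃ (n : ℕ) (t : V.space n ⊗[k] K), (V.space n).subtype.rTensor K t = x ∧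
      (V.toGr n).rTensor K t ≠ 0 := by
  classical
  have hex : ∃ n, ∃ t : V.space n ⊗[k] K, (V.space n).subtype.rTensor K t = x := by
    clear hx
    induction x using TensorProduct.induction_on with
    | zero => exact ⟨0, 0, map_zero _⟩
    | tmul b c =>
      obtain ⟨n, hn⟩ := V.exhaustive b
      exact ⟨n, ⟨b, hn⟩ ⊗ₜ c, by simp⟩
    | add x y hx hy =>
      obtain ⟨m, s, rfl⟩ := hx
      obtain ⟨n, t, rfl⟩ := hy
      refine ⟨max m n, (Submodule.inclusion (V.mono (le_max_left m n))).rTensor K s +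
        (Submodule.inclusion (V.mono (le_max_right m n))).rTensor K t, ?_⟩
      rw [map_add, ← LinearMap.rTensor_comp_apply, ← LinearMap.rTensor_comp_apply]
      rfl
  obtain ⟨t, ht⟩ := Nat.find_spec hex
  refine ⟨Nat.find hex, t, ht, fun h => ?_⟩
  generalize hn : Nat.find hex = n at t ht h
  have hinj : Function.Injective ((DirectSum.lof k ℕ V.Piece n).rTensor K) := by
    refine Function.LeftInverse.injective (g := (DirectSum.component k ℕ V.Piece n).rTensor K) ?_
    intro y
    rw [← LinearMap.rTensor_comp_apply]
    have : DirectSum.component k ℕ V.Piece n ∘ₗ DirectSum.lof k ℕ V.Piece n = LinearMap.id := by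
      ext y
      simp
    rw [this, LinearMap.rTensor_id_apply]
  have hproj : (V.proj n).rTensor K t = 0 := by
    apply hinj
    rw [map_zero, ← LinearMap.rTensor_comp_apply]
    exact h
  have hex2 : Function.Exact (V.predIn n).subtype (V.proj n) :=
    LinearMap.exact_subtype_mkQ (V.predIn n)
  have hex3 := @rTensor_exact k (V.predIn n) (V.space n) (V.Piece n) _ _ _ _ _ _ _
    (V.predIn n).subtype (V.proj n) K _ _ hex2 (V.proj_surjective n)
  obtain ⟨s, rfl⟩ := (hex3 t).1 hproj
  cases n with
  | zero =>
    apply hx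
    rw [← ht, ← LinearMap.rTensor_comp_apply]
    have : (V.space 0).subtype ∘ₗ (V.predIn 0).subtype = 0 := by
      ext y
      exact y.2
    rw [this, LinearMap.rTensor_zero, LinearMap.zero_apply]
  | succ n =>
    refine Nat.find_min hex (m := n) (by omega) ?_
    let g : V.predIn (n + 1) →ₗ[k] V.space n :=
      ((V.space (n + 1)).subtype ∘ₗ (V.predIn (n + 1)).subtype).codRestrict _ fun y => y.2
    refine ⟨g.rTensor K s, ?_⟩
    rw [← ht, ← LinearMap.rTensor_comp_apply, ← LinearMap.rTensor_comp_apply]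
    rfl

variable {V K}

/-- If the associated graded algebra has no zero divisors after a scalar extension, then neither
has the filtered algebra. -/
theorem baseChange_mul_ne_zero (h : ∀ x y : V.Gr ⊗[k] K, x * y = 0 → x = 0 ∨ y = 0)
    {x y : B ⊗[k] K} (hx : x ≠ 0) (hy : y ≠ 0) : x * y ≠ 0 := by
  obtain ⟨m, s, rfl, hs⟩ := V.exists_toGr_ne_zero K hx
  obtain ⟨n, t, rfl, ht⟩ := V.exists_toGr_ne_zero K hy
  obtain ⟨r, hr, hr'⟩ := V.exists_mul_lift K s t
  intro h0
  rw [h0] at hr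
  -- Flatness keeps `V (m + n) ⊗ K → B ⊗ K` injective.
  have hr0 : r = 0 := by
    apply Module.Flat.rTensor_preserves_injective_linearMap (M := K) _
      (V.space (m + n)).injective_subtype
    rw [hr, map_zero]
  rw [hr0, map_zero] at hr'
  exact (h _ _ hr'.symm).elim hs ht

theorem tmul_one_ne_zero {M : Type*} [AddCommGroup M] [Module k M] {x : M} (hx : x ≠ 0) :
    x ⊗ₜ[k] (1 : K) ≠ 0 := by
  intro h
  apply hx
  rw [← Module.FaithfullyFlat.one_tmul_eq_zero_iff k M (A := K)]
  simpa using congrArg (TensorProduct.comm k M K) h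

variable (V)

open Classical in
/-- The degree of an element, the least `n` with `x ∈ V n`. -/
noncomputable def degree (x : B) : ℕ := Nat.find (V.exhaustive x)

theorem mem_space_degree (x : B) : x ∈ V.space (V.degree x) := by
  classical exact Nat.find_spec (V.exhaustive x)

theorem degree_le {x : B} {n : ℕ} (h : x ∈ V.space n) : V.degree x ≤ n := by
  classical exact Nat.find_min' (V.exhaustive x) h

theorem notMem_pred_degree {x : B} (hx : x ≠ 0) : x ∉ V.pred (V.degree x) := by
  intro h
  generalize hn : V.degree x = n at h
  cases n with
  | zero => exact hx h
  | succ n =>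
    have := V.degree_le (n := n) h
    omega

variable {V}

/-- If the degree dropped, the product of the two nonzero leading symbols would be zero, and remain
so after tensoring with 1. -/
theorem degree_mul (h : ∀ x y : V.Gr ⊗[k] K, x * y = 0 → x = 0 ∨ y = 0) {x y : B} (hx : x ≠ 0)
    (hy : y ≠ 0) : V.degree (x * y) = V.degree x + V.degree y := by
  have hne : ∀ z : B, z ≠ 0 → DirectSum.of V.Piece _ (V.cls _ z (V.mem_space_degree z)) ≠ 0 := by
    intro z hz h0
    have h1 : V.cls _ z (V.mem_space_degree z) = 0 :=
      DirectSum.of_injective (V.degree z) (h0.trans (map_zero _).symm)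
    exact V.notMem_pred_degree hz ((V.proj_eq_zero_iff _).1 h1)
  refine le_antisymm (V.degree_le (V.mul_mem (V.mem_space_degree x) (V.mem_space_degree y))) ?_
  by_contra! hlt
  have hmem : x * y ∈ V.pred (V.degree x + V.degree y) := by
    generalize V.degree x + V.degree y = n at hlt
    cases n with
    | zero => omega
    | succ n => exact V.mono (Nat.lt_succ_iff.1 hlt) (V.mem_space_degree (x * y))
  have h0 : V.cls _ (x * y) (V.mul_mem (V.mem_space_degree x) (V.mem_space_degree y)) = 0 :=
    (V.proj_eq_zero_iff _).2 hmem
  have hmul := V.of_mul_of_cls (V.mem_space_degree x) (V.mem_space_degree y)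
  rw [h0, map_zero] at hmul
  rcases h (DirectSum.of V.Piece _ (V.cls _ x (V.mem_space_degree x)) ⊗ₜ 1)
    (DirectSum.of V.Piece _ (V.cls _ y (V.mem_space_degree y)) ⊗ₜ 1)
    (by rw [Algebra.TensorProduct.tmul_mul_tmul, hmul, TensorProduct.zero_tmul]) with h | h
  · exact tmul_one_ne_zero (hne x hx) h
  · exact tmul_one_ne_zero (hne y hy) h

theorem noZeroDivisors (h : ∀ x y : V.Gr ⊗[k] K, x * y = 0 → x = 0 ∨ y = 0) :
    NoZeroDivisors B where
  eq_zero_or_eq_zero_of_mul_eq_zero {x y} hxy := by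
    by_contra! hne
    refine baseChange_mul_ne_zero h (tmul_one_ne_zero hne.1) (tmul_one_ne_zero hne.2) ?_
    rw [Algebra.TensorProduct.tmul_mul_tmul, hxy, TensorProduct.zero_tmul]

/-! ### Factor pairs as rank-one tensors. -/

theorem eq_zero_of_sum_tmul_eq_zero {ι M : Type*} [Fintype ι] [AddCommGroup M] [Module k M]
    (b : Module.Basis ι k M) {v : ι → K} (h : ∑ i, b i ⊗ₜ[k] v i = 0) : v = 0 := by
  classical
  have h2 := congrArg (TensorProduct.equivFinsuppOfBasisLeft (N := K) b) h
  ext i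
  have h3 := DFunLike.congr_fun h2 i
  simpa [Finsupp.single_apply] using h3

theorem sum_tmul_mul_sum_tmul {ι ι' : Type*} [Fintype ι] [Fintype ι'] (b : ι → B) (b' : ι' → B)
    (v : ι → K) (w : ι' → K) :
    (∑ i, b i ⊗ₜ[k] v i) * (∑ j, b' j ⊗ₜ[k] w j) = ∑ i, ∑ j, (b i * b' j) ⊗ₜ[k] (v i * w j) := by
  simp only [Finset.sum_mul_sum, Algebra.TensorProduct.tmul_mul_tmul]

/-- The products `p * c` with value `a` and factors in a fixed finite-dimensional subspace have
only finitely many left factors up to scalars. -/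
theorem finite_factor_pairs [IsAlgClosed K]
    (h : ∀ x y : B ⊗[k] K, x * y = 0 → x = 0 ∨ y = 0) (E : Submodule k B)
    [FiniteDimensional k E] {a : B} (ha : a ≠ 0) :
    ∃ φ : B × B → (Fin (Module.finrank k E) × Fin (Module.finrank k E) → K),
      (φ '' {q | q.1 ∈ E ∧ q.2 ∈ E ∧ q.1 * q.2 = a}).Finite ∧
      ∀ q q' : B × B, q.1 ∈ E → q.2 ∈ E → q.1 * q.2 = a →
        q'.1 ∈ E → q'.2 ∈ E → q'.1 * q'.2 = a → φ q = φ q' →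
        ∃ r : k, r ≠ 0 ∧ q.1 = r • q'.1 := by
  classical
  let b := Module.finBasis k E
  let e := Module.Basis.ofVectorSpace k B
  let co : B → Fin (Module.finrank k E) → k := fun x =>
    if hx : x ∈ E then b.repr ⟨x, hx⟩ else 0
  have hco : ∀ x ∈ E, ∑ i, co x i • (b i : B) = x := by
    intro x hx
    have h1 := congrArg Subtype.val (b.sum_repr ⟨x, hx⟩)
    have h2 : co x = b.repr ⟨x, hx⟩ := dif_pos hx
    rw [Submodule.coe_sum] at h1
    rw [h2]
    exact h1
  -- Structure constants of the multiplication `E × E → B`; `φ` sends a pair to the coordinate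
  -- matrix of its tensor.
  let c := fun l i j => algebraMap k K (e.repr ((b i : B) * (b j : B)) l)
  refine ⟨fun q p => algebraMap k K (co q.1 p.1 * co q.2 p.2), ?_, ?_⟩
  · refine (finite_rankOne_of_bilinear c ?_ fun l => algebraMap k K (e.repr a l)).subset ?_
    · intro v w hvw
      have hinj : Function.Injective (E.subtype.rTensor K) :=
        Module.Flat.rTensor_preserves_injective_linearMap _ E.injective_subtype
      have hE : ∀ v : Fin (Module.finrank k E) → K, ∑ i, (b i : B) ⊗ₜ[k] v i = 0 → v = 0 := by
        intro v hv
        refine eq_zero_of_sum_tmul_eq_zero b (hinj ?_)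
        rw [map_zero, map_sum]
        exact hv
      refine (h _ _ ?_).imp (hE v) (hE w)
      rw [sum_tmul_mul_sum_tmul]
      apply (TensorProduct.equivFinsuppOfBasisLeft (N := K) e).injective
      ext l
      rw [map_zero, Finsupp.zero_apply, ← hvw l]
      simp [c, Algebra.smul_def]
    · rintro _ ⟨⟨p, q⟩, ⟨hp, hq, hpq⟩, rfl⟩
      refine ⟨fun i => algebraMap k K (co p i), fun j => algebraMap k K (co q j), by simp, ?_⟩
      intro l
      dsimp only at hp hq hpq
      have h1 : a = ∑ i, ∑ j, (co p i * co q j) • ((b i : B) * (b j : B)) := by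
        conv_lhs => rw [← hpq, ← hco p hp, ← hco q hq]
        simp only [Finset.sum_mul_sum, smul_mul_smul_comm]
      rw [h1]
      simp only [map_sum, Finsupp.finsetSum_apply, map_smul, Finsupp.smul_apply, smul_eq_mul,
        map_mul, c]
      exact Finset.sum_congr rfl fun i _ => Finset.sum_congr rfl fun j _ => mul_comm _ _
  · rintro ⟨p, q⟩ ⟨p', q'⟩ hp hq hpq hp' hq' hpq' heq
    dsimp only at *
    have hq0 : q ≠ 0 := by rintro rfl; simp [eq_comm, ha] at hpq
    have hp0 : p ≠ 0 := by rintro rfl; simp [eq_comm, ha] at hpq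
    have hcoeq : ∀ i j, co p i * co q j = co p' i * co q' j := fun i j =>
      (algebraMap k K).injective (congrFun heq (i, j))
    -- A column where `q` has a nonzero coordinate exhibits `p` as a multiple of `p'`, with ratio in
    -- `k` because all coordinates are.
    obtain ⟨j, hj⟩ : ∃ j, co q j ≠ 0 := by
      by_contra! hall
      apply hq0
      rw [← hco q hq]
      simp [hall]
    have hr : p = (co q' j / co q j) • p' := by
      rw [← hco p hp, ← hco p' hp', Finset.smul_sum]
      refine Finset.sum_congr rfl fun i _ => ?_
      rw [smul_smul]
      congr 1
      rw [div_mul_eq_mul_div, eq_div_iff hj, hcoeq, mul_comm]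
    refine ⟨_, ?_, hr⟩
    intro h0
    rw [h0, zero_smul] at hr
    exact hp0 hr

end Domain

end AlgFiltration

theorem centralAssoc_smul {k A : Type*} [Field k] [Ring A] [Algebra k A] {r : k} (hr : r ≠ 0)
    (x : A) : CentralAssoc x (r • x) :=
  ⟨(Units.mk0 r hr).map (algebraMap k A : k →* A),
    Subring.mem_center_iff.2 fun g => (Algebra.commutes r g).symm, Algebra.smul_def r x⟩

theorem forall₂_centralAssoc_of_left {A : Type*} [Ring A] {l l₁ l₂ : List A}
    (h₁ : List.Forall₂ CentralAssoc l l₁) (h₂ : List.Forall₂ CentralAssoc l l₂) :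
    List.Forall₂ CentralAssoc l₁ l₂ := by
  induction h₁ generalizing l₂ with
  | nil => exact h₂
  | cons hx _ ih =>
    cases h₂ with
    | cons hy hl => exact .cons (hx.symm.trans hy) (ih hl)

/-! ### Factorizations in the subalgebra. -/

namespace AlgFiltration

section Subalgebra

variable {k B K : Type*} [Field k] [Ring B] [Algebra k B] {V : AlgFiltration k B} [Field K]
  [Algebra k K] {A : Subalgebra k B}

/-- Left multiplication by `x` is injective on the finite-dimensional space `A ∩ V 0`, hence
surjective, and this space contains 1 since `deg 1 = 2 deg 1`. -/
theorem isUnit_of_degree_eq_zero [Nontrivial B] [FiniteDimensional k (V.space 0)]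
    (h : ∀ x y : V.Gr ⊗[k] K, x * y = 0 → x = 0 ∨ y = 0) {x : A} (hx : x ≠ 0)
    (hdeg : V.degree (x : B) = 0) : IsUnit x := by
  have := noZeroDivisors h
  have : IsDomain A := NoZeroDivisors.to_isDomain A
  let W : Submodule k A := (V.space 0).comap A.val.toLinearMap
  have h1 : (1 : A) ∈ W := by
    have h1 := degree_mul h (one_ne_zero (α := B)) (one_ne_zero (α := B))
    rw [mul_one] at h1
    have h0 : V.degree (1 : B) = 0 := by omega
    have := V.mem_space_degree (1 : B)
    rwa [h0] at this
  have hxW : (x : B) ∈ V.space 0 := hdeg ▸ V.mem_space_degree (x : B)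
  let i : W →ₗ[k] V.space 0 := A.val.toLinearMap.restrict fun _ hy => hy
  have hi : Function.Injective i := fun y z hyz =>
    Subtype.ext (Subtype.ext (congrArg (fun t : V.space 0 => (t : B)) hyz))
  have : FiniteDimensional k W := FiniteDimensional.of_injective i hi
  let m : W →ₗ[k] W := (LinearMap.mulLeft k x).restrict fun y hy =>
    V.mul_mem (m := 0) (n := 0) hxW hy
  have hm : Function.Injective m := fun y z hyz =>
    Subtype.ext (mul_left_cancel₀ hx (congrArg Subtype.val hyz))
  obtain ⟨y, hy⟩ := LinearMap.surjective_of_injective hm ⟨1, h1⟩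
  exact IsUnit.of_mul_eq_one (y : A) (congrArg Subtype.val hy)

theorem exists_irreducible_list_prod_eq [Nontrivial B] [FiniteDimensional k (V.space 0)]
    (h : ∀ x y : V.Gr ⊗[k] K, x * y = 0 → x = 0 ∨ y = 0) (n : ℕ) :
    ∀ a : A, a ≠ 0 → ¬ IsUnit a → V.degree (a : B) = n →
      ∃ l : List A, (∀ p ∈ l, Irreducible p) ∧ l.prod = a := by
  induction n using Nat.strong_induction_on with
  | _ n ih =>
    intro a ha hau hn
    by_cases hirr : Irreducible a
    · exact ⟨[a], by simpa using hirr, by simp⟩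
    rw [irreducible_iff] at hirr
    push Not at hirr
    obtain ⟨b, c, rfl, hb, hc⟩ := hirr hau
    have hb0 : b ≠ 0 := left_ne_zero_of_mul ha
    have hc0 : c ≠ 0 := right_ne_zero_of_mul ha
    have hdeg : V.degree ((b * c : A) : B) = V.degree (b : B) + V.degree (c : B) :=
      degree_mul h (by simpa using hb0) (by simpa using hc0)
    have hb1 : V.degree (b : B) ≠ 0 := fun h0 => hb (isUnit_of_degree_eq_zero h hb0 h0)
    have hc1 : V.degree (c : B) ≠ 0 := fun h0 => hc (isUnit_of_degree_eq_zero h hc0 h0)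
    obtain ⟨l, hl, hlb⟩ := ih _ (by omega) b hb0 hb rfl
    obtain ⟨l', hl', hlc⟩ := ih _ (by omega) c hc0 hc rfl
    refine ⟨l ++ l', fun p hp => ?_, by rw [List.prod_append, hlb, hlc]⟩
    exact (List.mem_append.1 hp).elim (hl p) (hl' p)

theorem exists_finite_left_factors [Nontrivial B] [IsAlgClosed K] (hV : V.IsFiniteDimensional)
    (h : ∀ x y : V.Gr ⊗[k] K, x * y = 0 → x = 0 ∨ y = 0) {a : A} (ha : a ≠ 0) :
    ∃ F : Set (A × A), F.Finite ∧ (∀ q ∈ F, q.1 * q.2 = a) ∧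
      ∀ p c : A, p * c = a → ∃ q ∈ F, ∃ r : k, r ≠ 0 ∧ p = r • q.1 := by
  have hB : ∀ x y : B ⊗[k] K, x * y = 0 → x = 0 ∨ y = 0 := fun x y hxy => by
    by_contra! hne
    exact baseChange_mul_ne_zero h hne.1 hne.2 hxy
  have := hV (V.degree (a : B))
  have ha' : (a : B) ≠ 0 := by simpa using ha
  obtain ⟨φ, hfin, hφ⟩ := finite_factor_pairs hB (V.space (V.degree (a : B))) ha'
  have hmem : ∀ q : A × A, q.1 * q.2 = a → (q.1 : B) ∈ V.space (V.degree (a : B)) ∧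
      (q.2 : B) ∈ V.space (V.degree (a : B)) ∧ (q.1 * q.2 : B) = a := by
    rintro ⟨p, c⟩ rfl
    have hdeg : V.degree ((p * c : A) : B) = V.degree (p : B) + V.degree (c : B) :=
      degree_mul h (by simpa using left_ne_zero_of_mul ha) (by simpa using right_ne_zero_of_mul ha)
    exact ⟨V.mono (by simp only [hdeg]; omega) (V.mem_space_degree _),
      V.mono (by simp only [hdeg]; omega) (V.mem_space_degree _), rfl⟩
  let ψ : A × A → _ := fun q => φ (q.1, q.2)
  -- One pair is chosen in each fibre of `ψ`, so the representatives stay in `A`.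
  obtain ⟨F, hF, hbij⟩ := Set.exists_subset_bijOn {q : A × A | q.1 * q.2 = a} ψ
  refine ⟨F, ?_, hF, ?_⟩
  · rw [hbij.finite_iff_finite]
    refine hfin.subset ?_
    rintro _ ⟨q, hq, rfl⟩
    exact ⟨(q.1, q.2), hmem q hq, rfl⟩
  · intro p c hpc
    obtain ⟨q, hq, hqφ⟩ := hbij.surjOn ⟨(p, c), hpc, rfl⟩
    have h1 := hmem (p, c) hpc
    have h2 := hmem q (hF hq)
    obtain ⟨r, hr, hpr⟩ := hφ (p, c) (q.1, q.2) h1.1 h1.2.1 h1.2.2 h2.1 h2.2.1 h2.2.2 hqφ.symm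
    exact ⟨q, hq, r, hr, Subtype.ext hpr⟩

/-- The scalar `r` is there for the induction: replacing the first factor by its representative
leaves a product known only up to a scalar. Non-units suffice in place of irreducibles, since only
positivity of their degree matters. -/
theorem exists_finite_factorizations [Nontrivial B] [IsAlgClosed K] (hV : V.IsFiniteDimensional)
    (h : ∀ x y : V.Gr ⊗[k] K, x * y = 0 → x = 0 ∨ y = 0) (n : ℕ) :
    ∀ a : A, a ≠ 0 → V.degree (a : B) < n → ∃ L : Set (List A), L.Finite ∧
      ∀ l : List A, (∀ p ∈ l, ¬ IsUnit p) → ∀ r : k, r ≠ 0 → l.prod = r • a →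
        ∃ l' ∈ L, List.Forall₂ CentralAssoc l' l := by
  have := hV 0
  have := noZeroDivisors h
  have : IsDomain A := NoZeroDivisors.to_isDomain A
  induction n with
  | zero => intro a _ h0; omega
  | succ n ih =>
    intro a ha hn
    obtain ⟨F, hF, hFa, hcover⟩ := exists_finite_left_factors hV h ha
    have hrest : ∀ q : A × A, ∃ L : Set (List A), L.Finite ∧ (q ∈ F → ¬ IsUnit q.1 →
        ∀ l : List A, (∀ p ∈ l, ¬ IsUnit p) → ∀ r : k, r ≠ 0 → l.prod = r • q.2 →
          ∃ l' ∈ L, List.Forall₂ CentralAssoc l' l) := by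
      intro q
      by_cases hq : q ∈ F ∧ ¬ IsUnit q.1
      · have hne : q.1 * q.2 ≠ 0 := by rwa [hFa q hq.1]
        have h1 := left_ne_zero_of_mul hne
        have h2 := right_ne_zero_of_mul hne
        have hdeg : V.degree ((q.1 * q.2 : A) : B) = V.degree (q.1 : B) + V.degree (q.2 : B) :=
          degree_mul h (by simpa using h1) (by simpa using h2)
        rw [hFa q hq.1] at hdeg
        have hpos : V.degree (q.1 : B) ≠ 0 := fun h0 =>
          hq.2 (isUnit_of_degree_eq_zero h h1 h0)
        obtain ⟨L, hL, hL'⟩ := ih q.2 h2 (by omega)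
        exact ⟨L, hL, fun _ _ => hL'⟩
      · exact ⟨∅, Set.finite_empty, fun h1 h2 => absurd ⟨h1, h2⟩ hq⟩
    choose L hL hL' using hrest
    refine ⟨{[]} ∪ ⋃ q ∈ F, List.cons q.1 '' L q,
      (Set.finite_singleton _).union (hF.biUnion fun q _ => (hL q).image _), ?_⟩
    intro l hl r hr hprod
    cases l with
    | nil => exact ⟨[], .inl rfl, .nil⟩
    | cons p l =>
      rw [List.prod_cons] at hprod
      -- Absorbing `r` into the cofactor makes `p` an exact left factor of `a`.
      obtain ⟨q, hq, s, hs, rfl⟩ := hcover p (r⁻¹ • l.prod) (by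
        rw [mul_smul_comm, hprod, smul_smul, inv_mul_cancel₀ hr, one_smul])
      have hq0 : q.1 ≠ 0 := left_ne_zero_of_mul (by rwa [hFa q hq])
      have hqu : ¬ IsUnit q.1 := fun hu => hl (s • q.1) (by simp)
        (by simpa using hu.smul (Units.mk0 s hs))
      have hprod' : l.prod = (s⁻¹ * r) • q.2 := by
        apply mul_left_cancel₀ hq0
        rw [mul_smul_comm, hFa q hq, mul_smul, ← hprod, smul_mul_assoc, smul_smul,
          inv_mul_cancel₀ hs, one_smul]
      obtain ⟨l', hl', hll⟩ := hL' q hq hqu l (fun p hp => hl p (List.mem_cons_of_mem _ hp)) _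
        (mul_ne_zero (inv_ne_zero hs) hr) hprod'
      exact ⟨q.1 :: l', .inr (Set.mem_biUnion hq ⟨l', hl', rfl⟩), .cons (centralAssoc_smul hs _) hll⟩

end Subalgebra

end AlgFiltration

open AlgFiltration in
theorem mainTheorem7 {k B : Type*} [Field k] [Ring B] [Algebra k B] (A : Subalgebra k B)
    (V : AlgFiltration k B) (hV : V.IsFiniteDimensional)
    (hdom : IsNoncommDomain (V.Gr ⊗[k] AlgebraicClosure k)) :
    IsFFD A := by
  have h := hdom.eq_zero_or_eq_zero
  have := hV 0
  have : Nontrivial B := by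
    by_contra hB
    rw [not_nontrivial_iff_subsingleton] at hB
    have hpiece : ∀ n, Subsingleton (V.Piece n) := fun n => (V.proj_surjective n).subsingleton
    have hgr : Subsingleton V.Gr := ⟨fun x y => DFinsupp.ext fun n => Subsingleton.elim _ _⟩
    obtain ⟨x, hx⟩ := hdom.exists_ne_zero
    exact hx (Subsingleton.elim _ _)
  have := noZeroDivisors h
  refine ⟨NoZeroDivisors.to_isDomain A, fun a ha hu => ?_, fun a ha hu => ?_⟩
  · obtain ⟨l, hl⟩ := exists_irreducible_list_prod_eq h _ a ha hu rfl
    exact ⟨⟨l, hl⟩⟩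
  · obtain ⟨L, hL, hL'⟩ := exists_finite_factorizations hV h _ a ha (Nat.lt_succ_self _)
    have hrep : ∀ f : IrredFactorization a, ∃ l ∈ L, List.Forall₂ CentralAssoc l f.1 := fun f =>
      hL' f.1 (fun p hp => (f.2.1 p hp).not_isUnit) 1 one_ne_zero (by rw [f.2.2, one_smul])
    choose g hgL hg using hrep
    have := hL.to_subtype
    -- Factorizations matched to the same list of `L` are identified, so the classes inject into
    -- `L`.
    refine Finite.of_injective (β := L) (fun c => ⟨g c.out, hgL _⟩) fun c d hcd => ?_
    have hcd' : g c.out = g d.out := congrArg Subtype.val hcd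
    rw [← c.out_eq, ← d.out_eq]
    apply Quotient.sound
    exact forall₂_centralAssoc_of_left (hg c.out) (hcd' ▸ hg d.out)
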